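/- Let $a<b$ be real, and let $M$ be either the interval $[a,b]$ or the circle obtained from $[a,b]$ by identifying $a$ with $b$; let $\pi:[a,b]\to M$ be the canonical map, and let $\mathcal B$ be the Borel $\sigma$-algebra of $M$. Let $\tau:M\to M$ be continuous and uniquely ergodic, i.e. there is exactly one $\tau$-invariant Borel probability measure $\mu$ on $M$, and assume that $\mu$ is the image under $\pi$ of a measure on $[a,b]$ which is absolutely continuous with respect to Lebesgue measure with a continuous density. Let $(\Omega,\mathcal F,P)$ be a probability space and $(\theta_k)_{k\in\mathbb Z^d}$ a group of measure-preserving transformations of it ($\theta_0=\mathrm{Id}$, $\theta_{k+l}=\theta_k\circ\theta_l$) for which $P$ is strongly mixing, i.e. $P(A\cap\theta_k^{-1}B)\to P(A)P(B)$ as $\|k\|\to\infty$ for all $A,B\in\mathcal F$, where $\|\cdot\|$ is the maximum norm. Let $\kappa:M\to\mathbb Z^d$ be measurable, put $\kappa_n(t)=\sum_{i=0}^{n-1}\kappa(\tau^i t)$, and assume that for every $m\in\mathbb N$ $$\lim_{n\to\infty}\frac1{n^2}\sup_{t\in M}\bigl|\{(i,j): 1\le i,j\le n,\ \|\kappa_i(t)-\kappa_j(t)\|\le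 m\}\bigr|=0 .$$ Let $1\le p<\infty$ and let $F:M\times\Omega\to\mathbb R$ be $\mathcal B\otimes\mathcal F$-measurable with $F\in L^p(\mu\otimes P)$ and $\sup_{t\in M}|F(t,\cdot)|\in L^p(P)$, and assume that for $P$-almost every $\omega$ the function $s\mapsto F(\pi(s),\omega)$ is Riemann-integrable on $[a,b]$. Then $$\lim_{n\to\infty}\ \sup_{t\in M}\ \Bigl\|\frac1n\sum_{i=0}^{n-1}F\bigl(\tau^i(t),\theta_{\kappa_i(t)}\,\cdot\,\bigr)-\int F\,d(\mu\otimes P)\Bigr\|_{L^p(P)}=0 .$$ -/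

import Mathlib

open MeasureTheory Filter Topology
open scoped NNReal ENNReal

/-- `M`, with the map `π : [a,b] → M`, is the interval `[a,b]` itself (when `π` is injective) or the
circle obtained from `[a,b]` by identifying the two end points (when `π a = π b`): `π` is a continuous
surjection which identifies no two points, except possibly `a` and `b`.
(As `[a,b]` is compact and `M` will be Hausdorff, `π` is then a quotient map.) -/
structure IsIntervalOrCircle {M : Type*} [TopologicalSpace M] (a b : ℝ) (π : Set.Icc a b → M) :
    Prop where
  continuous : Continuous π
  surjective : Function.Surjective π
  eq_or_endpoints : ∀ s t : Set.Icc a b, π s = π t →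
    s = t ∨ ((s : ℝ) = a ∧ (t : ℝ) = b) ∨ ((s : ℝ) = b ∧ (t : ℝ) = a)

/-- Riemann integrability of `f : [a,b] → ℝ` (Darboux's form): `f` is bounded, and for every `ε > 0`
some partition `a = x₀ ≤ x₁ ≤ ⋯ ≤ xₙ = b` has upper sum minus lower sum smaller than `ε`. -/
def RiemannIntegrable {a b : ℝ} (f : Set.Icc a b → ℝ) : Prop :=
  (∃ C : ℝ, ∀ t, |f t| ≤ C) ∧
  ∀ ε : ℝ, 0 < ε → ∃ (n : ℕ) (x : Fin (n + 1) → Set.Icc a b),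
    Monotone x ∧ (x 0 : ℝ) = a ∧ (x (Fin.last n) : ℝ) = b ∧
    ∑ i : Fin n, (sSup (f '' Set.Icc (x i.castSucc) (x i.succ)) -
        sInf (f '' Set.Icc (x i.castSucc) (x i.succ))) *
      ((x i.succ : ℝ) - (x i.castSucc : ℝ)) < ε

/-- `μ` is an invariant measure of the transformation `τ`, and it is the only invariant Borel
probability measure of `τ`. -/
structure UniquelyErgodicWith {M : Type*} [MeasurableSpace M] (τ : M → M) (μ : Measure M) :
    Prop where
  measurePreserving : MeasurePreserving τ μ μ
  unique : ∀ ν : Measure M, IsProbabilityMeasure ν → MeasurePreserving τ ν ν → ν = μ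

/-- A `d`-parameter group `(θ_k)`, `k ∈ ℤ^d`, of measure-preserving transformations. -/
structure IsMeasurePreservingGroup {Ω : Type*} [MeasurableSpace Ω] (P : Measure Ω) {d : ℕ}
    (θ : (Fin d → ℤ) → Ω → Ω) : Prop where
  measurePreserving : ∀ k, MeasurePreserving (θ k) P P
  zero : θ 0 = id
  add : ∀ k l, θ (k + l) = θ k ∘ θ l

/-- `P` is strongly mixing for `(θ_k)`: `P(A ∩ θ_k⁻¹ B) → P(A) P(B)` as `‖k‖ → ∞`, for all
measurable `A`, `B`. The norm of `Fin d → ℤ` is the maximum norm. -/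
def StronglyMixing {Ω : Type*} [MeasurableSpace Ω] (P : Measure Ω) {d : ℕ}
    (θ : (Fin d → ℤ) → Ω → Ω) : Prop :=
  ∀ A B : Set Ω, MeasurableSet A → MeasurableSet B →
    Tendsto (fun k => P.real (A ∩ θ k ⁻¹' B)) (comap (fun k : Fin d → ℤ => ‖k‖) atTop)
      (𝓝 (P.real A * P.real B))

/-- The growth condition on `κ : M → ℤ^d` along `τ`. With `κ_i = ∑_{l < i} κ ∘ τ^l`
(`birkhoffSum τ κ i`), for every `m`,
`n⁻² sup_t #{(i, j) : 1 ≤ i, j ≤ n, ‖κ_i(t) - κ_j(t)‖ ≤ m} → 0` as `n → ∞`. -/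
def CouplingGrowth {M : Type*} {d : ℕ} (τ : M → M) (κ : M → Fin d → ℤ) : Prop :=
  ∀ m : ℕ, Tendsto
    (fun n : ℕ => 1 / (n : ℝ) ^ 2 *
      ⨆ t : M, ((((Finset.Icc 1 n ×ˢ Finset.Icc 1 n).filter fun q : ℕ × ℕ =>
        ‖birkhoffSum τ κ q.1 t - birkhoffSum τ κ q.2 t‖ ≤ (m : ℝ)).card : ℕ) : ℝ))
    atTop (𝓝 0)

/-! Write `Φ s = F (s, ·)`, an element of `L^p(P)`, and `U_k` for the isometry of `L^p(P)` given by
composition with `θ k`. The random average is then `1/n ∑ U_{κ_i(t)} Φ(τ^i t)`, and the claim is its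
convergence to `∫ F`, uniformly in `t`. Uniformity is expressed by the filter `atTop ×ˢ ⊤` on pairs
`(n, t)`.

Suppose first that `Φ = f G` with `f` continuous and `G` a fixed vector. For constant `G`, unique
ergodicity suffices. For `G` a centred indicator, the mean square is an average of covariances over
pairs `(i, j)`: by the growth condition most pairs have `κ_i(t)`, `κ_j(t)` far apart, where strong
mixing makes the covariance small. Linearity and density give every `G`, because the averages are
contractions (`tendsto_average_koopman`).

For general `Φ`, Riemann integrability makes almost every `F (·, ω)` continuous `μ`-almost
everywhere. Hence `Φ` is close to some `∑ φ_j Φ(j)`, with `φ_j` a fine continuous partition of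
unity, up to an error dominated at every point by a continuous function `∑ φ_j D_j` of small
integral (`exists_partition_of_unity_approx`). As this bound is continuous and holds everywhere,
unique ergodicity controls its averages along every orbit, not just almost every one
(`tendsto_average_of_approx`). -/

/-! ### Unique ergodicity and uniform averages of continuous functions -/

/-- The empirical measure of the first `n` points of the orbit of `t`. -/
noncomputable def empiricalMeasure {M : Type*} [MeasurableSpace M] (τ : M → M) (n : ℕ) (t : M) :
    Measure M :=
  (n : ℝ≥0∞)⁻¹ • ∑ i ∈ Finset.range n, Measure.dirac (τ^[i] t)

lemma isProbabilityMeasure_empiricalMeasure {M : Type*} [MeasurableSpace M] (τ : M → M) {n : ℕ}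
    (hn : n ≠ 0) (t : M) : IsProbabilityMeasure (empiricalMeasure τ n t) := by
  constructor
  simp only [empiricalMeasure, Measure.smul_apply, Measure.finsetSum_apply, measure_univ,
    Finset.sum_const, Finset.card_range, nsmul_eq_mul, mul_one, smul_eq_mul]
  exact ENNReal.inv_mul_cancel (by exact_mod_cast hn) (ENNReal.natCast_ne_top n)

lemma integral_empiricalMeasure {M : Type*} [TopologicalSpace M] [MeasurableSpace M] [BorelSpace M]
    (τ : M → M) (n : ℕ) (t : M) {f : M → ℝ} (hf : Continuous f) :
    ∫ s, f s ∂(empiricalMeasure τ n t) = 1 / (n : ℝ) * ∑ i ∈ Finset.range n, f (τ^[i] t) := by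
  have hm : StronglyMeasurable f := hf.measurable.stronglyMeasurable
  rw [empiricalMeasure, integral_smul_measure, integral_finsetSum_measure]
  · simp [integral_dirac' _ _ hm]
  · intro i _
    exact (integrable_dirac' hm (by simp))

/-- The ergodic averages of a continuous function under a uniquely ergodic transformation of a
compact metric space converge uniformly. -/
lemma UniquelyErgodicWith.tendsto_average {M : Type*} [MetricSpace M] [CompactSpace M]
    [MeasurableSpace M] [BorelSpace M] {τ : M → M} (hτ : Continuous τ) {μ : Measure M}
    (hμ : UniquelyErgodicWith τ μ) {f : M → ℝ} (hf : Continuous f) :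
    Tendsto (fun q : ℕ × M => 1 / (q.1 : ℝ) * ∑ i ∈ Finset.range q.1, f (τ^[i] q.2))
      (atTop ×ˢ ⊤) (𝓝 (∫ s, f s ∂μ)) := by
  -- Probability measures on `M` form a compact space, so along any ultrafilter the empirical
  -- measures converge. The limit is invariant, hence equal to `μ`.
  rw [tendsto_iff_ultrafilter]
  intro 𝒰 h𝒰
  have hfst : Tendsto (fun q : ℕ × M => q.1) 𝒰 atTop := tendsto_fst.mono_left h𝒰
  have hpos : ∀ᶠ q : ℕ × M in 𝒰, q.1 ≠ 0 := hfst.eventually (eventually_ne_atTop 0)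
  obtain ⟨q₀, hq₀⟩ := hpos.exists
  -- For `n = 0` the empirical measure is zero; an arbitrary probability measure replaces it there,
  -- which `𝒰` does not see.
  let ν : ℕ × M → ProbabilityMeasure M := fun q =>
    if h : q.1 ≠ 0 then ⟨empiricalMeasure τ q.1 q.2, isProbabilityMeasure_empiricalMeasure τ h q.2⟩
    else ⟨empiricalMeasure τ q₀.1 q₀.2, isProbabilityMeasure_empiricalMeasure τ hq₀ q₀.2⟩
  have hint : ∀ g : M → ℝ, Continuous g → ∀ᶠ q : ℕ × M in 𝒰, ∫ s, g s ∂(ν q : Measure M)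
      = 1 / (q.1 : ℝ) * ∑ i ∈ Finset.range q.1, g (τ^[i] q.2) := by
    intro g hg
    filter_upwards [hpos] with q hq
    have hνq : ν q = ⟨empiricalMeasure τ q.1 q.2,
      isProbabilityMeasure_empiricalMeasure τ hq q.2⟩ := dif_pos hq
    rw [hνq]
    exact integral_empiricalMeasure τ q.1 q.2 hg
  obtain ⟨ν₀, -, hν₀⟩ := isCompact_univ.ultrafilter_le_nhds (𝒰.map ν) (by simp)
  have hlim : Tendsto ν 𝒰 (𝓝 ν₀) := hν₀
  rw [ProbabilityMeasure.tendsto_iff_forall_integral_tendsto] at hlim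
  have hinv : ∀ g : BoundedContinuousFunction M ℝ,
      ∫ s, g s ∂(Measure.map τ ν₀) = ∫ s, g s ∂(ν₀ : Measure M) := by
    intro g
    rw [integral_map hτ.aemeasurable g.continuous.measurable.aestronglyMeasurable]
    have h1 := hlim g
    have h2 := hlim (g.compContinuous ⟨τ, hτ⟩)
    have h3 := h2.sub h1
    -- The averages of `g ∘ τ` and `g` differ by a telescoping sum, leaving two boundary terms
    -- divided by `n`.
    have h4 : Tendsto (fun q : ℕ × M => 2 * ‖g‖ / (q.1 : ℝ)) 𝒰 (𝓝 0) :=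
      tendsto_const_nhds.div_atTop (tendsto_natCast_atTop_atTop.comp hfst)
    have h5 := tendsto_nhds_unique h3 (squeeze_zero_norm' ?_ h4)
    · simpa [sub_eq_zero] using h5
    filter_upwards [hint g g.continuous, hint _ (g.continuous.comp hτ)] with q e1 e2
    simp only [Function.comp_apply] at e2
    simp only [BoundedContinuousFunction.compContinuous_apply, ContinuousMap.coe_mk]
    rw [e1, e2, ← mul_sub, ← Finset.sum_sub_distrib]
    have htel : ∑ i ∈ Finset.range q.1, (g (τ (τ^[i] q.2)) - g (τ^[i] q.2))
        = g (τ^[q.1] q.2) - g (τ^[0] q.2) := by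
      rw [← Finset.sum_range_sub (fun i => g (τ^[i] q.2))]
      exact Finset.sum_congr rfl fun i _ => by rw [Function.iterate_succ_apply']
    rw [htel, norm_mul, norm_div, norm_one, RCLike.norm_natCast, one_div_mul_eq_div]
    gcongr
    refine (norm_sub_le _ _).trans ?_
    have := g.norm_coe_le_norm (τ^[q.1] q.2)
    have := g.norm_coe_le_norm (τ^[0] q.2)
    linarith
  have hmap : Measure.map τ ν₀ = ν₀ := by
    have : IsProbabilityMeasure (Measure.map τ (ν₀ : Measure M)) :=
      Measure.isProbabilityMeasure_map hτ.aemeasurable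
    exact ext_of_forall_integral_eq_of_IsFiniteMeasure hinv
  have hν : (ν₀ : Measure M) = μ := hμ.unique _ inferInstance ⟨hτ.measurable, hmap⟩
  rw [← hν]
  exact (hlim (BoundedContinuousFunction.mkOfCompact ⟨f, hf⟩)).congr' (hint f hf)

/-! ### Koopman isometries and the mean on `L^p` -/

/-- The Koopman operator of `θ k` on `L^p`. -/
noncomputable def IsMeasurePreservingGroup.koopman {Ω : Type*} [MeasurableSpace Ω] {P : Measure Ω}
    {d : ℕ} {θ : (Fin d → ℤ) → Ω → Ω} (hθ : IsMeasurePreservingGroup P θ) (p : ℝ≥0∞)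
    [Fact (1 ≤ p)] (k : Fin d → ℤ) : Lp ℝ p P →ₗᵢ[ℝ] Lp ℝ p P :=
  Lp.compMeasurePreservingₗᵢ ℝ (θ k) (hθ.measurePreserving k)

lemma IsMeasurePreservingGroup.koopman_toLp {Ω : Type*} [MeasurableSpace Ω] {P : Measure Ω}
    {d : ℕ} {θ : (Fin d → ℤ) → Ω → Ω} (hθ : IsMeasurePreservingGroup P θ) (p : ℝ≥0∞)
    [Fact (1 ≤ p)] (k : Fin d → ℤ) {g : Ω → ℝ} (hg : MemLp g p P) :
    hθ.koopman p k (hg.toLp g) =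
      (hg.comp_measurePreserving (hθ.measurePreserving k)).toLp (g ∘ θ k) := rfl

/-- The integral as a continuous linear functional on the `L^p` space of a probability measure. -/
noncomputable def integralLp {Ω : Type*} [MeasurableSpace Ω] (P : Measure Ω)
    [IsProbabilityMeasure P] (p : ℝ≥0∞) [hp : Fact (1 ≤ p)] : Lp ℝ p P →L[ℝ] ℝ :=
  LinearMap.mkContinuous
    { toFun := fun G => ∫ ω, G ω ∂P
      map_add' := fun G H => by
        rw [integral_congr_ae (Lp.coeFn_add G H)]
        exact integral_add ((Lp.memLp G).integrable hp.out) ((Lp.memLp H).integrable hp.out)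
      map_smul' := fun c G => by
        rw [integral_congr_ae (Lp.coeFn_smul c G)]
        exact integral_const_mul c _ }
    1 fun G => by
      have h : ‖∫ ω, G ω ∂P‖ₑ ≤ eLpNorm G p P := by
        refine (enorm_integral_le_lintegral_enorm _).trans ?_
        rw [← eLpNorm_one_eq_lintegral_enorm]
        exact eLpNorm_le_eLpNorm_of_exponent_le hp.out (Lp.aestronglyMeasurable G)
      rw [one_mul, Lp.norm_def]
      have := ENNReal.toReal_mono (Lp.eLpNorm_ne_top G) h
      simpa using this

lemma integralLp_toLp {Ω : Type*} [MeasurableSpace Ω] (P : Measure Ω)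
    [IsProbabilityMeasure P] (p : ℝ≥0∞) [Fact (1 ≤ p)] {g : Ω → ℝ} (hg : MemLp g p P) :
    integralLp P p (hg.toLp g) = ∫ ω, g ω ∂P :=
  integral_congr_ae hg.coeFn_toLp

lemma abs_integralLp_le {Ω : Type*} [MeasurableSpace Ω] (P : Measure Ω)
    [IsProbabilityMeasure P] (p : ℝ≥0∞) [Fact (1 ≤ p)] (G : Lp ℝ p P) :
    |integralLp P p G| ≤ ‖G‖ := by
  have h : ‖integralLp P p‖ ≤ 1 := LinearMap.mkContinuous_norm_le _ zero_le_one _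
  simpa using (integralLp P p).le_of_opNorm_le h G

/-! ### Decorrelation along the cocycle -/

/-- The proportion of pairs of times at which the cocycle differs by at most `m` tends to zero
uniformly. -/
lemma CouplingGrowth.tendsto_card {M : Type*} {d : ℕ} {τ : M → M} {κ : M → Fin d → ℤ}
    (h : CouplingGrowth τ κ) (m : ℕ) :
    Tendsto (fun q : ℕ × M => 1 / (q.1 : ℝ) ^ 2 *
      (((Finset.range q.1 ×ˢ Finset.range q.1).filter fun r : ℕ × ℕ =>
        ‖birkhoffSum τ κ r.1 q.2 - birkhoffSum τ κ r.2 q.2‖ ≤ (m : ℝ)).card : ℝ))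
      (atTop ×ˢ ⊤) (𝓝 0) := by
  -- The hypothesis counts times `1, …, n`, the averages use `0, …, n - 1`. At most `2n` pairs have
  -- a zero coordinate, which costs `2n / n² = 2 / n`.
  have h1 : Tendsto (fun q : ℕ × M => 2 / (q.1 : ℝ)) (atTop ×ˢ ⊤) (𝓝 0) :=
    tendsto_const_nhds.div_atTop (tendsto_natCast_atTop_atTop.comp tendsto_fst)
  have h2 := h1.add ((h m).comp (tendsto_fst (f := atTop) (g := (⊤ : Filter M))))
  rw [add_zero] at h2
  refine squeeze_zero (fun q => by positivity) (fun q => ?_) h2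
  obtain ⟨n, t⟩ := q
  simp only [Function.comp_apply]
  let B : M → Finset (ℕ × ℕ) := fun t => (Finset.Icc 1 n ×ˢ Finset.Icc 1 n).filter
    fun r : ℕ × ℕ => ‖birkhoffSum τ κ r.1 t - birkhoffSum τ κ r.2 t‖ ≤ (m : ℝ)
  -- The bound `n²` is needed: an unbounded real supremum would be `0`.
  have hB : ((B t).card : ℝ) ≤ ⨆ t, ((B t).card : ℝ) := by
    refine le_ciSup (f := fun t => ((B t).card : ℝ)) ⟨(n * n : ℕ), ?_⟩ t
    rintro _ ⟨s, rfl⟩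
    simp only [Nat.cast_le]
    refine (Finset.card_filter_le _ _).trans ?_
    simp
  have hsub : ((Finset.range n ×ˢ Finset.range n).filter fun r : ℕ × ℕ =>
      ‖birkhoffSum τ κ r.1 t - birkhoffSum τ κ r.2 t‖ ≤ (m : ℝ)) ⊆
      ({0} ×ˢ Finset.range n ∪ Finset.range n ×ˢ {0}) ∪ B t := by
    rintro ⟨i, j⟩ hr
    simp only [Finset.mem_filter, Finset.mem_product, Finset.mem_range] at hr
    simp only [B, Finset.mem_union, Finset.mem_product, Finset.mem_singleton, Finset.mem_range,
      Finset.mem_filter, Finset.mem_Icc]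
    by_cases hi : i = 0
    · exact Or.inl (Or.inl ⟨hi, hr.1.2⟩)
    by_cases hj : j = 0
    · exact Or.inl (Or.inr ⟨hr.1.1, hj⟩)
    exact Or.inr ⟨by omega, hr.2⟩
  have hcard := (Finset.card_le_card hsub).trans ((Finset.card_union_le _ _).trans
    (Nat.add_le_add_right (Finset.card_union_le _ _) _))
  simp only [Finset.card_product, Finset.card_singleton, Finset.card_range, one_mul,
    mul_one] at hcard
  have hcard' : (((Finset.range n ×ˢ Finset.range n).filter fun r : ℕ × ℕ =>
      ‖birkhoffSum τ κ r.1 t - birkhoffSum τ κ r.2 t‖ ≤ (m : ℝ)).card : ℝ) ≤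
      2 * n + ⨆ t, ((B t).card : ℝ) := by
    refine le_trans ?_ (add_le_add_right hB _)
    rw [two_mul]
    exact_mod_cast hcard
  rcases Nat.eq_zero_or_pos n with rfl | hn
  · simp
  have hn' : (0 : ℝ) < n := by exact_mod_cast hn
  calc _ ≤ 1 / (n : ℝ) ^ 2 * (2 * n + ⨆ t, ((B t).card : ℝ)) := by gcongr
    _ = _ := by
      rw [mul_add]
      congr 1
      field_simp

/-- Strong mixing, for the correlation of two translates of the same event. -/
lemma StronglyMixing.exists_correlation_le {Ω : Type*} [MeasurableSpace Ω] {P : Measure Ω}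
    [IsProbabilityMeasure P] {d : ℕ} {θ : (Fin d → ℤ) → Ω → Ω}
    (hθ : IsMeasurePreservingGroup P θ) (hmix : StronglyMixing P θ) {A : Set Ω}
    (hA : MeasurableSet A) {ε : ℝ} (hε : 0 < ε) :
    ∃ m : ℕ, ∀ k l : Fin d → ℤ, (m : ℝ) < ‖k - l‖ →
      |P.real (θ k ⁻¹' A ∩ θ l ⁻¹' A) - P.real A * P.real A| ≤ ε := by
  have h := (hmix A A hA hA).eventually (Metric.closedBall_mem_nhds _ hε)
  rw [eventually_comap, eventually_atTop] at h
  obtain ⟨r, hr⟩ := h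
  obtain ⟨m, hm⟩ := exists_nat_ge r
  refine ⟨m, fun k l hkl => ?_⟩
  have hl : θ l = θ (l - k) ∘ θ k := by rw [← hθ.add, sub_add_cancel]
  have h1 : θ k ⁻¹' A ∩ θ l ⁻¹' A = θ k ⁻¹' (A ∩ θ (l - k) ⁻¹' A) := by
    rw [hl, Set.preimage_inter, Set.preimage_comp]
  have h2 : P.real (θ k ⁻¹' A ∩ θ l ⁻¹' A) = P.real (A ∩ θ (l - k) ⁻¹' A) := by
    rw [h1]
    exact (hθ.measurePreserving k).measureReal_preimage
      (hA.inter ((hθ.measurePreserving _).measurable hA)).nullMeasurableSet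
  rw [h2]
  exact hr ‖l - k‖ (by rw [norm_sub_rev]; linarith) (l - k) rfl

/-- Functions bounded by `1` which tend to zero in mean square tend to zero in `L^p`. -/
lemma tendsto_eLpNorm_of_tendsto_integral_sq {Ω α : Type*} [MeasurableSpace Ω] {P : Measure Ω}
    [IsProbabilityMeasure P] {l : Filter α} {X : α → Ω → ℝ} (hX : ∀ q, Measurable (X q))
    (hX1 : ∀ q ω, |X q ω| ≤ 1) (h : Tendsto (fun q => ∫ ω, X q ω ^ 2 ∂P) l (𝓝 0))
    {p : ℝ≥0∞} (hp1 : 1 ≤ p) (hp : p ≠ ∞) :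
    Tendsto (fun q => eLpNorm (X q) p P) l (𝓝 0) := by
  have hp0 : 0 < p.toReal := ENNReal.toReal_pos (by positivity) hp
  have hp1' : 1 ≤ p.toReal := by simpa using ENNReal.toReal_mono hp hp1
  -- The comparison is `‖X‖_p ≤ ‖X‖_2 ^ (1/p)`: since `|X| ≤ 1`, `∫ |X|^p ≤ ∫ |X| ≤ ‖X‖_2`.
  have h1 : Tendsto (fun q => ((ENNReal.ofReal (∫ ω, X q ω ^ 2 ∂P)) ^ (1 / 2 : ℝ)) ^ (1 / p.toReal))
      l (𝓝 0) := by
    have h2 := (ENNReal.continuous_rpow_const (y := 1 / p.toReal)).tendsto _ |>.comp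
      ((ENNReal.continuous_rpow_const (y := (1 / 2 : ℝ))).tendsto _ |>.comp
        (ENNReal.tendsto_ofReal h))
    have h3 : 0 < 1 / p.toReal := by positivity
    rw [ENNReal.ofReal_zero, ENNReal.zero_rpow_of_pos (by norm_num),
      ENNReal.zero_rpow_of_pos h3] at h2
    exact h2
  refine tendsto_of_tendsto_of_tendsto_of_le_of_le tendsto_const_nhds h1 (fun _ => zero_le) ?_
  intro q
  have hle : ∀ ω, ‖X q ω‖ₑ ≤ 1 := fun ω => by
    rw [← ofReal_norm]
    simpa using hX1 q ω
  have h2 : eLpNorm (X q) 2 P = (ENNReal.ofReal (∫ ω, X q ω ^ 2 ∂P)) ^ (1 / 2 : ℝ) := by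
    rw [eLpNorm_eq_lintegral_rpow_enorm_toReal (by simp) (by simp)]
    simp only [ENNReal.toReal_ofNat]
    congr 1
    rw [ofReal_integral_eq_lintegral_ofReal]
    · refine lintegral_congr fun ω => ?_
      rw [← ofReal_norm, ENNReal.ofReal_rpow_of_nonneg (norm_nonneg _) (by norm_num)]
      simp
    · refine Integrable.of_bound ((hX q).pow_const 2).aestronglyMeasurable 1 (ae_of_all _ ?_)
      intro ω
      simpa using hX1 q ω
    · exact ae_of_all _ fun ω => sq_nonneg _
  beta_reduce
  rw [← h2, eLpNorm_eq_lintegral_rpow_enorm_toReal (by positivity) hp]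
  refine ENNReal.rpow_le_rpow ?_ (by positivity)
  calc ∫⁻ ω, ‖X q ω‖ₑ ^ p.toReal ∂P ≤ ∫⁻ ω, ‖X q ω‖ₑ ∂P := by
        refine lintegral_mono fun ω => ?_
        simpa using ENNReal.rpow_le_rpow_of_exponent_ge (hle ω) hp1'
    _ = eLpNorm (X q) 1 P := eLpNorm_one_eq_lintegral_enorm.symm
    _ ≤ eLpNorm (X q) 2 P := eLpNorm_le_eLpNorm_of_exponent_le (by norm_num)
        (hX q).aestronglyMeasurable

/-- The centred indicator function of an event. -/
noncomputable def centredIndicator {Ω : Type*} [MeasurableSpace Ω] (P : Measure Ω) (A : Set Ω)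
    (ω : Ω) : ℝ :=
  A.indicator (fun _ => (1 : ℝ)) ω - P.real A

lemma measurable_centredIndicator {Ω : Type*} [MeasurableSpace Ω] (P : Measure Ω) {A : Set Ω}
    (hA : MeasurableSet A) : Measurable (centredIndicator P A) :=
  (measurable_const.indicator hA).sub_const _

lemma abs_centredIndicator_le {Ω : Type*} [MeasurableSpace Ω] (P : Measure Ω)
    [IsProbabilityMeasure P] (A : Set Ω) (ω : Ω) : |centredIndicator P A ω| ≤ 1 := by
  have h0 : 0 ≤ P.real A := measureReal_nonneg
  have h1 : P.real A ≤ 1 := measureReal_le_one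
  rw [centredIndicator, abs_le]
  by_cases h : ω ∈ A <;> simp [h] <;> linarith

/-- The covariance formula by which mean squares of averages become sums of correlations, to which
strong mixing applies. -/
lemma integral_centredIndicator_mul {Ω : Type*} [MeasurableSpace Ω] {P : Measure Ω}
    [IsProbabilityMeasure P] {f g : Ω → Ω} (hf : MeasurePreserving f P P)
    (hg : MeasurePreserving g P P) {A : Set Ω} (hA : MeasurableSet A) :
    ∫ ω, centredIndicator P A (f ω) * centredIndicator P A (g ω) ∂P =
      P.real (f ⁻¹' A ∩ g ⁻¹' A) - P.real A * P.real A := by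
  set c := P.real A with hc
  have hfA := hf.measurable hA
  have hgA := hg.measurable hA
  have i1 : Integrable ((f ⁻¹' A ∩ g ⁻¹' A).indicator fun _ => (1 : ℝ)) P :=
    (integrable_const 1).indicator (hfA.inter hgA)
  have i2 : Integrable (fun ω => c * (f ⁻¹' A).indicator (fun _ => (1 : ℝ)) ω) P :=
    ((integrable_const 1).indicator hfA).const_mul c
  have i3 : Integrable (fun ω => c * (g ⁻¹' A).indicator (fun _ => (1 : ℝ)) ω) P :=
    ((integrable_const 1).indicator hgA).const_mul c
  have e : ∀ ω, centredIndicator P A (f ω) * centredIndicator P A (g ω) =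
      (f ⁻¹' A ∩ g ⁻¹' A).indicator (fun _ => (1 : ℝ)) ω
        - c * (f ⁻¹' A).indicator (fun _ => (1 : ℝ)) ω
        - c * (g ⁻¹' A).indicator (fun _ => (1 : ℝ)) ω + c * c := by
    intro ω
    simp only [centredIndicator, ← hc]
    by_cases h1 : f ω ∈ A <;> by_cases h2 : g ω ∈ A <;> simp [h1, h2] <;> ring
  have m1 : P.real (f ⁻¹' A) = c := hf.measureReal_preimage hA.nullMeasurableSet
  have m2 : P.real (g ⁻¹' A) = c := hg.measureReal_preimage hA.nullMeasurableSet
  simp only [e]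
  have i12 : Integrable (fun ω => (f ⁻¹' A ∩ g ⁻¹' A).indicator (fun _ => (1 : ℝ)) ω
      - c * (f ⁻¹' A).indicator (fun _ => (1 : ℝ)) ω) P := i1.sub i2
  have i123 : Integrable (fun ω => (f ⁻¹' A ∩ g ⁻¹' A).indicator (fun _ => (1 : ℝ)) ω
      - c * (f ⁻¹' A).indicator (fun _ => (1 : ℝ)) ω
      - c * (g ⁻¹' A).indicator (fun _ => (1 : ℝ)) ω) P := i12.sub i3
  rw [integral_add i123 (integrable_const _), integral_sub i12 i3,
    integral_sub i1 i2, integral_const_mul, integral_const_mul,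
    integral_indicator_const _ (hfA.inter hgA), integral_indicator_const _ hfA,
    integral_indicator_const _ hgA, m1, m2]
  simp

/-- Weighted averages of a centred indicator function along the cocycle tend to zero in mean
square, uniformly. -/
lemma tendsto_integral_sq_average {M Ω : Type*} [MeasurableSpace Ω] {P : Measure Ω}
    [IsProbabilityMeasure P] {d : ℕ} {θ : (Fin d → ℤ) → Ω → Ω}
    (hθ : IsMeasurePreservingGroup P θ) (hmix : StronglyMixing P θ)
    {τ : M → M} {κ : M → Fin d → ℤ} (hgrowth : CouplingGrowth τ κ) {A : Set Ω}
    (hA : MeasurableSet A) {f : M → ℝ} (hf : ∀ s, |f s| ≤ 1) :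
    Tendsto (fun q : ℕ × M => ∫ ω, (1 / (q.1 : ℝ) * ∑ i ∈ Finset.range q.1,
      f (τ^[i] q.2) * centredIndicator P A (θ (birkhoffSum τ κ i q.2) ω)) ^ 2 ∂P)
      (atTop ×ˢ ⊤) (𝓝 0) := by
  have hr1 : ∀ k l, |P.real (θ k ⁻¹' A ∩ θ l ⁻¹' A) - P.real A * P.real A| ≤ 1 := by
    intro k l
    have h0 : 0 ≤ P.real A := measureReal_nonneg
    have h1 : P.real A ≤ 1 := measureReal_le_one
    have h2 : 0 ≤ P.real (θ k ⁻¹' A ∩ θ l ⁻¹' A) := measureReal_nonneg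
    have h3 : P.real (θ k ⁻¹' A ∩ θ l ⁻¹' A) ≤ 1 := measureReal_le_one
    rw [abs_le]
    constructor <;> nlinarith
  have hint : ∀ q : ℕ × M, ∫ ω, (1 / (q.1 : ℝ) * ∑ i ∈ Finset.range q.1,
      f (τ^[i] q.2) * centredIndicator P A (θ (birkhoffSum τ κ i q.2) ω)) ^ 2 ∂P =
      1 / (q.1 : ℝ) ^ 2 * ∑ r ∈ Finset.range q.1 ×ˢ Finset.range q.1,
        f (τ^[r.1] q.2) * f (τ^[r.2] q.2) *
          (P.real (θ (birkhoffSum τ κ r.1 q.2) ⁻¹' A ∩ θ (birkhoffSum τ κ r.2 q.2) ⁻¹' A)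
            - P.real A * P.real A) := by
    rintro ⟨n, t⟩
    have hm : ∀ k, Measurable fun ω => centredIndicator P A (θ k ω) := fun k =>
      (measurable_centredIndicator P hA).comp (hθ.measurePreserving k).measurable
    have hi : ∀ k l, Integrable
        (fun ω => centredIndicator P A (θ k ω) * centredIndicator P A (θ l ω)) P := fun k l => by
      refine Integrable.of_bound ((hm k).mul (hm l)).aestronglyMeasurable 1 (ae_of_all _ ?_)
      intro ω
      rw [norm_mul]
      exact mul_le_one₀ (abs_centredIndicator_le P A _) (norm_nonneg _)
        (abs_centredIndicator_le P A _)
    simp only [mul_pow, sq (∑ i ∈ Finset.range n, _), Finset.sum_mul_sum,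
      ← Finset.sum_product']
    rw [integral_const_mul, one_div_pow, integral_finsetSum]
    · congr 1
      refine Finset.sum_congr rfl fun r _ => ?_
      rw [← integral_centredIndicator_mul (hθ.measurePreserving _) (hθ.measurePreserving _) hA,
        ← integral_const_mul]
      congr 1 with ω
      ring
    · intro r _
      refine ((hi (birkhoffSum τ κ r.1 t) (birkhoffSum τ κ r.2 t)).const_mul
        (f (τ^[r.1] t) * f (τ^[r.2] t))).congr (ae_of_all _ fun ω => ?_)
      dsimp only
      ring
  rw [Metric.tendsto_nhds]
  intro ε hε
  obtain ⟨m, hm⟩ := hmix.exists_correlation_le hθ hA (half_pos hε)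
  filter_upwards [(hgrowth.tendsto_card m).eventually (gt_mem_nhds (half_pos hε)),
    (tendsto_fst (f := atTop) (g := (⊤ : Filter M))).eventually (eventually_ne_atTop 0)] with q hq hn
  rw [Real.dist_0_eq_abs, abs_of_nonneg (integral_nonneg fun ω => sq_nonneg _), hint]
  obtain ⟨n, t⟩ := q
  simp only at hq hn ⊢
  have hn' : (0 : ℝ) < n := by positivity
  set S := Finset.range n ×ˢ Finset.range n
  -- Close pairs get the trivial bound `1`, and there are few of them; far pairs get the mixing
  -- bound `ε / 2`.
  have hterm : ∀ r ∈ S, f (τ^[r.1] t) * f (τ^[r.2] t) *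
      (P.real (θ (birkhoffSum τ κ r.1 t) ⁻¹' A ∩ θ (birkhoffSum τ κ r.2 t) ⁻¹' A)
            - P.real A * P.real A) ≤
      (if ‖birkhoffSum τ κ r.1 t - birkhoffSum τ κ r.2 t‖ ≤ (m : ℝ) then 1 else 0) + ε / 2 := by
    intro r _
    have h1 : |f (τ^[r.1] t) * f (τ^[r.2] t)| ≤ 1 := by
      rw [abs_mul]
      exact mul_le_one₀ (hf _) (abs_nonneg _) (hf _)
    refine (le_abs_self _).trans ?_
    rw [abs_mul]
    refine (mul_le_of_le_one_left (abs_nonneg _) h1).trans ?_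
    split_ifs with h
    · linarith [hr1 (birkhoffSum τ κ r.1 t) (birkhoffSum τ κ r.2 t)]
    · rw [zero_add]
      exact hm _ _ (not_le.mp h)
  have hsum := Finset.sum_le_sum hterm
  rw [Finset.sum_add_distrib, Finset.sum_boole, Finset.sum_const, nsmul_eq_mul] at hsum
  have hS : (S.card : ℝ) = (n : ℝ) ^ 2 := by
    simp [S, sq]
  rw [hS] at hsum
  calc _ ≤ 1 / (n : ℝ) ^ 2 * (((S.filter fun r : ℕ × ℕ =>
        ‖birkhoffSum τ κ r.1 t - birkhoffSum τ κ r.2 t‖ ≤ (m : ℝ)).card : ℝ)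
          + (n : ℝ) ^ 2 * (ε / 2)) := by gcongr
    _ = 1 / (n : ℝ) ^ 2 * ((S.filter fun r : ℕ × ℕ =>
        ‖birkhoffSum τ κ r.1 t - birkhoffSum τ κ r.2 t‖ ≤ (m : ℝ)).card : ℝ) + ε / 2 := by
      field_simp
    _ < ε := by linarith

/-! ### Averages of a fixed vector of `L^p` -/

/-- Weighted averages along the cocycle of a fixed element of `L^p` converge in `L^p` to a
constant, uniformly. -/
lemma tendsto_average_koopman {M Ω : Type*} [MetricSpace M] [CompactSpace M]
    [MeasurableSpace M] [BorelSpace M] {τ : M → M} (hτ : Continuous τ) {μ : Measure M}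
    (hμ : UniquelyErgodicWith τ μ) [MeasurableSpace Ω] {P : Measure Ω}
    [IsProbabilityMeasure P] {d : ℕ} {θ : (Fin d → ℤ) → Ω → Ω}
    (hθ : IsMeasurePreservingGroup P θ) (hmix : StronglyMixing P θ)
    {κ : M → Fin d → ℤ} (hgrowth : CouplingGrowth τ κ) {p : ℝ≥0∞} [Fact (1 ≤ p)] (hp : p ≠ ∞)
    {f : M → ℝ} (hfc : Continuous f) (hf : ∀ s, |f s| ≤ 1) (G : Lp ℝ p P) :
    Tendsto (fun q : ℕ × M => (1 / (q.1 : ℝ)) • ∑ i ∈ Finset.range q.1,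
      f (τ^[i] q.2) • hθ.koopman p (birkhoffSum τ κ i q.2) G)
      (atTop ×ˢ ⊤)
      (𝓝 ((∫ s, f s ∂μ) • integralLp P p G • (memLp_const (1 : ℝ)).toLp (fun _ : Ω => (1 : ℝ)))) := by
  have hp1 : 1 ≤ p := Fact.out
  set one : Lp ℝ p P := (memLp_const (1 : ℝ)).toLp (fun _ : Ω => (1 : ℝ)) with hone
  let T : ℕ × M → Lp ℝ p P →ₗ[ℝ] Lp ℝ p P := fun q => (1 / (q.1 : ℝ)) • ∑ i ∈ Finset.range q.1,
      f (τ^[i] q.2) • (hθ.koopman p (birkhoffSum τ κ i q.2)).toLinearMap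
  have hT : ∀ q G, T q G = (1 / (q.1 : ℝ)) • ∑ i ∈ Finset.range q.1,
      f (τ^[i] q.2) • hθ.koopman p (birkhoffSum τ κ i q.2) G := by
    intro q G
    simp [T]
  have hTle : ∀ q G, ‖T q G‖ ≤ ‖G‖ := by
    intro q G
    rw [hT, norm_smul, norm_div, norm_one, RCLike.norm_natCast]
    have h1 : ‖∑ i ∈ Finset.range q.1, f (τ^[i] q.2) • hθ.koopman p (birkhoffSum τ κ i q.2) G‖
        ≤ q.1 * ‖G‖ := by
      refine (norm_sum_le _ _).trans ?_
      refine (Finset.sum_le_card_nsmul _ _ ‖G‖ fun i _ => ?_).trans (by simp)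
      rw [norm_smul, LinearIsometry.norm_map]
      exact mul_le_of_le_one_left (norm_nonneg _) (hf _)
    refine (mul_le_mul_of_nonneg_left h1 (by positivity)).trans ?_
    rw [← mul_assoc, one_div]
    exact mul_le_of_le_one_left (norm_nonneg _) inv_mul_le_one
  let V : Lp ℝ p P → Lp ℝ p P := fun G => (∫ s, f s ∂μ) • integralLp P p G • one
  have hVc : Continuous V := by fun_prop
  have hVadd : ∀ G H, V (G + H) = V G + V H := by
    intro G H
    simp only [V, map_add, add_smul, smul_add]
  have hVsmul : ∀ (c : ℝ) G, V (c • G) = c • V G := by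
    intro c G
    simp only [V, map_smul, smul_eq_mul, mul_smul]
    rw [smul_comm]
  suffices h : ∀ G, Tendsto (fun q => T q G) (atTop ×ˢ ⊤) (𝓝 (V G)) by
    simpa only [hT] using h G
  -- Koopman operators fix constants, so only the scalar averages of `f` remain.
  have honeT : Tendsto (fun q => T q one) (atTop ×ˢ ⊤) (𝓝 (V one)) := by
    have h1 : V one = (∫ s, f s ∂μ) • one := by
      simp only [V, hone, integralLp_toLp]
      simp
    have h2 : ∀ q, T q one = (1 / (q.1 : ℝ) * ∑ i ∈ Finset.range q.1, f (τ^[i] q.2)) • one := by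
      intro q
      rw [hT, mul_smul, Finset.sum_smul]
      rfl
    rw [h1]
    simp only [h2]
    exact (hμ.tendsto_average hτ hfc).smul_const one
  have hcent : ∀ {A : Set Ω} (hA : MeasurableSet A) (hg : MemLp (centredIndicator P A) p P),
      Tendsto (fun q => T q (hg.toLp _)) (atTop ×ˢ ⊤) (𝓝 0) := by
    intro A hA hg
    let X : ℕ × M → Ω → ℝ := fun q ω => 1 / (q.1 : ℝ) * ∑ i ∈ Finset.range q.1,
      f (τ^[i] q.2) * centredIndicator P A (θ (birkhoffSum τ κ i q.2) ω)
    have hXm : ∀ q, Measurable (X q) := fun q =>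
      (Finset.measurable_sum _ fun i _ => ((measurable_centredIndicator P hA).comp
        (hθ.measurePreserving _).measurable).const_mul _).const_mul _
    have hX1 : ∀ q ω, |X q ω| ≤ 1 := by
      intro q ω
      simp only [X]
      rw [abs_mul, abs_div, abs_one, Nat.abs_cast]
      have h1 : |∑ i ∈ Finset.range q.1, f (τ^[i] q.2) *
          centredIndicator P A (θ (birkhoffSum τ κ i q.2) ω)| ≤ q.1 := by
        refine (Finset.abs_sum_le_sum_abs _ _).trans ?_
        refine (Finset.sum_le_card_nsmul _ _ 1 fun i _ => ?_).trans (by simp)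
        rw [abs_mul]
        exact mul_le_one₀ (hf _) (abs_nonneg _) (abs_centredIndicator_le P A _)
      refine (mul_le_mul_of_nonneg_left h1 (by positivity)).trans ?_
      rw [one_div]
      exact inv_mul_le_one
    have hlim := tendsto_eLpNorm_of_tendsto_integral_sq hXm hX1
      (tendsto_integral_sq_average hθ hmix hgrowth hA hf) hp1 hp
    rw [tendsto_zero_iff_norm_tendsto_zero]
    have h2 := (ENNReal.tendsto_toReal ENNReal.zero_ne_top).comp hlim
    rw [ENNReal.toReal_zero] at h2
    refine h2.congr fun q => ?_
    have h3 : T q (hg.toLp _) =ᵐ[P] X q := by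
      rw [hT]
      have h4 : ∀ i ∈ Finset.range q.1,
          ((f (τ^[i] q.2) • hθ.koopman p (birkhoffSum τ κ i q.2) (hg.toLp _) : Lp ℝ p P) : Ω → ℝ)
          =ᵐ[P] fun ω => f (τ^[i] q.2) * centredIndicator P A (θ (birkhoffSum τ κ i q.2) ω) := by
        intro i _
        rw [hθ.koopman_toLp]
        filter_upwards [Lp.coeFn_smul (f (τ^[i] q.2)) ((hg.comp_measurePreserving
          (hθ.measurePreserving (birkhoffSum τ κ i q.2))).toLp _),
          (hg.comp_measurePreserving
          (hθ.measurePreserving (birkhoffSum τ κ i q.2))).coeFn_toLp] with ω h5 h6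
        rw [h5, Pi.smul_apply, h6]
        rfl
      filter_upwards [Lp.coeFn_smul (1 / (q.1 : ℝ)) (∑ i ∈ Finset.range q.1,
        f (τ^[i] q.2) • hθ.koopman p (birkhoffSum τ κ i q.2) (hg.toLp _)),
        Lp.coeFn_finsetSum (Finset.range q.1)
          (fun i => f (τ^[i] q.2) • hθ.koopman p (birkhoffSum τ κ i q.2) (hg.toLp _)),
        (Finset.range q.1).eventually_all.mpr h4] with ω h5 h6 h7
      rw [h5, Pi.smul_apply, h6, smul_eq_mul, Finset.sum_apply, Finset.sum_congr rfl h7]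
    rw [Function.comp_apply, Lp.norm_def, eLpNorm_congr_ae h3]
  intro G
  induction G using Lp.induction hp with
  | indicatorConst c hs hμs =>
    rename_i A
    have hg : MemLp (centredIndicator P A) p P :=
      MemLp.of_bound (measurable_centredIndicator P hs).aestronglyMeasurable 1
        (ae_of_all _ (abs_centredIndicator_le P A))
    -- An indicator is its centred part plus the constant `P A`.
    have h1 : ((Lp.simpleFunc.indicatorConst p hs hμs.ne c : Lp.simpleFunc ℝ p P) : Lp ℝ p P) =
        c • (hg.toLp _ + P.real A • one) := by
      rw [Lp.simpleFunc.coe_indicatorConst, hone, ← MemLp.toLp_const_smul, ← MemLp.toLp_add,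
        ← MemLp.toLp_const_smul, indicatorConstLp]
      congr 1
      ext ω
      by_cases h : ω ∈ A <;> simp [h, centredIndicator]
    have h2 : V (hg.toLp _) = 0 := by
      have h3 : ∫ ω, centredIndicator P A ω ∂P = 0 := by
        simp only [centredIndicator]
        rw [integral_sub ((integrable_const _).indicator hs) (integrable_const _),
          integral_indicator_const _ hs]
        simp
      simp only [V, integralLp_toLp, h3, zero_smul, smul_zero]
    rw [h1]
    simp only [hVsmul, hVadd, map_add, map_smul, h2]
    exact (((hcent hs hg).add (honeT.const_smul _))).const_smul c
  | add hf hg _ h1 h2 =>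
    simp only [map_add, hVadd]
    exact h1.add h2
  | isClosed =>
    -- The maps `T q` are contractions, hence equicontinuous, so the vectors for which convergence
    -- holds form a closed set.
    refine Equicontinuous.isClosed_setOfPred_tendsto (F := fun q G => T q G) ?_ hVc
    refine (LipschitzWith.uniformEquicontinuous _ 1 fun q => ?_).equicontinuous
    refine LipschitzWith.of_dist_le_mul fun G H => ?_
    rw [dist_eq_norm, dist_eq_norm, ← map_sub]
    simpa using hTle q (G - H)

/-! ### Averages of a vector-valued function -/

/-- If the weighted averages of fixed vectors along an orbit converge uniformly, so do the averages
of a vector-valued function `Φ` which is close to piecewise constant functions in the mean. -/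
lemma tendsto_average_of_approx {M E : Type*} [TopologicalSpace M] [CompactSpace M]
    [MeasurableSpace M] [OpensMeasurableSpace M]
    [NormedAddCommGroup E] [NormedSpace ℝ E] {μ : Measure M} [IsProbabilityMeasure μ] {τ : M → M}
    (T : ℕ → M → E →ₗᵢ[ℝ] E) {e : E} (he : ‖e‖ ≤ 1) (ℓ : E →L[ℝ] ℝ) (hℓ : ∀ v, |ℓ v| ≤ ‖v‖)
    {Φ : M → E} (hΦ : Integrable (fun s => ℓ (Φ s)) μ)
    (hmean : ∀ f : M → ℝ, Continuous f →
      Tendsto (fun q : ℕ × M => 1 / (q.1 : ℝ) * ∑ i ∈ Finset.range q.1, f (τ^[i] q.2))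
        (atTop ×ˢ ⊤) (𝓝 (∫ s, f s ∂μ)))
    (hfix : ∀ f : M → ℝ, Continuous f → (∀ s, |f s| ≤ 1) → ∀ G : E,
      Tendsto (fun q : ℕ × M => (1 / (q.1 : ℝ)) • ∑ i ∈ Finset.range q.1,
        f (τ^[i] q.2) • T i q.2 G) (atTop ×ˢ ⊤) (𝓝 ((∫ s, f s ∂μ) • ℓ G • e)))
    (happ : ∀ ε : ℝ, 0 < ε → ∃ (J : Finset M) (φ : M → M → ℝ) (D : M → ℝ),
      (∀ j, Continuous (φ j)) ∧ (∀ j s, 0 ≤ φ j s) ∧ (∀ s, ∑ j ∈ J, φ j s = 1) ∧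
      (∀ j ∈ J, ∀ s, φ j s ≠ 0 → ‖Φ s - Φ j‖ ≤ D j) ∧ ∑ j ∈ J, (∫ s, φ j s ∂μ) * D j < ε) :
    Tendsto (fun q : ℕ × M => (1 / (q.1 : ℝ)) • ∑ i ∈ Finset.range q.1,
      T i q.2 (Φ (τ^[i] q.2))) (atTop ×ˢ ⊤) (𝓝 ((∫ s, ℓ (Φ s) ∂μ) • e)) := by
  rw [Metric.tendsto_nhds]
  intro ε hε
  obtain ⟨J, φ, D, hc, h0, h1, hD, hsum⟩ := happ (ε / 3) (by positivity)
  have hle : ∀ j ∈ J, ∀ s, |φ j s| ≤ 1 := fun j hj s => by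
    rw [abs_of_nonneg (h0 j s), ← h1 s]
    exact Finset.single_le_sum (f := fun j => φ j s) (fun i _ => h0 i s) hj
  have hint : ∀ j, Integrable (φ j) μ := fun j =>
    (hc j).integrable_of_hasCompactSupport (HasCompactSupport.of_compactSpace _)
  -- Because the weights sum to `1`, the error is a weighted sum of `L (Φ s - Φ j)`; only those `j`
  -- with `φ j s ≠ 0` contribute, and there `D j` applies.
  have hpt : ∀ s, ∀ L : E →L[ℝ] E, (∀ v, ‖L v‖ ≤ ‖v‖) →
      ‖L (Φ s) - ∑ j ∈ J, φ j s • L (Φ j)‖ ≤ ∑ j ∈ J, φ j s * D j := by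
    intro s L hL
    have : L (Φ s) - ∑ j ∈ J, φ j s • L (Φ j) = ∑ j ∈ J, φ j s • L (Φ s - Φ j) := by
      simp only [map_sub, smul_sub, Finset.sum_sub_distrib, ← Finset.sum_smul, h1, one_smul]
    rw [this]
    refine (norm_sum_le _ _).trans (Finset.sum_le_sum fun j hj => ?_)
    rw [norm_smul, Real.norm_of_nonneg (h0 j s)]
    rcases eq_or_ne (φ j s) 0 with h | h
    · simp [h]
    · exact mul_le_mul_of_nonneg_left ((hL _).trans (hD j hj s h)) (h0 j s)
  have hlimB : Tendsto (fun q : ℕ × M => ∑ j ∈ J, (1 / (q.1 : ℝ)) • ∑ i ∈ Finset.range q.1,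
      φ j (τ^[i] q.2) • T i q.2 (Φ j)) (atTop ×ˢ ⊤)
      (𝓝 (∑ j ∈ J, (∫ s, φ j s ∂μ) • ℓ (Φ j) • e)) :=
    tendsto_finsetSum _ fun j hj => hfix (φ j) (hc j) (hle j hj) (Φ j)
  have hlimD := hmean (fun s => ∑ j ∈ J, φ j s * D j) (by fun_prop)
  have hintD : ∫ s, ∑ j ∈ J, φ j s * D j ∂μ = ∑ j ∈ J, (∫ s, φ j s ∂μ) * D j := by
    rw [integral_finsetSum _ fun j _ => (hint j).mul_const _]
    exact Finset.sum_congr rfl fun j _ => integral_mul_const _ _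
  rw [hintD] at hlimD
  have hconst : ‖∑ j ∈ J, (∫ s, φ j s ∂μ) • ℓ (Φ j) • e - (∫ s, ℓ (Φ s) ∂μ) • e‖ ≤
      ∑ j ∈ J, (∫ s, φ j s ∂μ) * D j := by
    have e1 : ∑ j ∈ J, (∫ s, φ j s ∂μ) • ℓ (Φ j) • e - (∫ s, ℓ (Φ s) ∂μ) • e =
        (∫ s, (∑ j ∈ J, φ j s * ℓ (Φ j) - ℓ (Φ s)) ∂μ) • e := by
      rw [integral_sub (integrable_finsetSum _ fun j _ => (hint j).mul_const _) hΦ,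
        integral_finsetSum _ fun j _ => (hint j).mul_const _, sub_smul, Finset.sum_smul]
      simp only [integral_mul_const, mul_smul]
    rw [e1, norm_smul, ← hintD]
    refine (mul_le_of_le_one_right (norm_nonneg _) he).trans ?_
    refine norm_integral_le_of_norm_le
      (integrable_finsetSum _ fun j _ => (hint j).mul_const _) (ae_of_all _ fun s => ?_)
    have e2 : ∑ j ∈ J, φ j s * ℓ (Φ j) - ℓ (Φ s) = ∑ j ∈ J, φ j s * ℓ (Φ j - Φ s) := by
      simp only [map_sub, mul_sub, Finset.sum_sub_distrib, ← Finset.sum_mul, h1, one_mul]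
    rw [e2]
    refine (norm_sum_le _ _).trans (Finset.sum_le_sum fun j hj => ?_)
    rw [norm_mul, Real.norm_of_nonneg (h0 j s)]
    rcases eq_or_ne (φ j s) 0 with h | h
    · simp [h]
    · refine mul_le_mul_of_nonneg_left ((hℓ _).trans ?_) (h0 j s)
      rw [norm_sub_rev]
      exact hD j hj s h
  filter_upwards [(Metric.tendsto_nhds.mp hlimB) (ε / 3) (by positivity),
    hlimD.eventually (gt_mem_nhds hsum)] with q hq1 hq2
  rw [dist_eq_norm] at hq1 ⊢
  have hAB : ‖(1 / (q.1 : ℝ)) • ∑ i ∈ Finset.range q.1, T i q.2 (Φ (τ^[i] q.2)) -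
      ∑ j ∈ J, (1 / (q.1 : ℝ)) • ∑ i ∈ Finset.range q.1, φ j (τ^[i] q.2) • T i q.2 (Φ j)‖ ≤
      1 / (q.1 : ℝ) * ∑ i ∈ Finset.range q.1, ∑ j ∈ J, φ j (τ^[i] q.2) * D j := by
    rw [← Finset.smul_sum, Finset.sum_comm, ← smul_sub, ← Finset.sum_sub_distrib, norm_smul,
      norm_div, norm_one, RCLike.norm_natCast]
    refine mul_le_mul_of_nonneg_left ?_ (by positivity)
    refine (norm_sum_le _ _).trans (Finset.sum_le_sum fun i _ => ?_)
    exact hpt _ (T i q.2).toContinuousLinearMap fun v => ((T i q.2).norm_map v).le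
  -- Each of the three terms is below `ε / 3`: approximation along the orbit, convergence for fixed
  -- vectors, approximation of the limit.
  calc _ ≤ _ := norm_sub_le_norm_sub_add_norm_sub _
        (∑ j ∈ J, (1 / (q.1 : ℝ)) • ∑ i ∈ Finset.range q.1, φ j (τ^[i] q.2) • T i q.2 (Φ j)) _
    _ ≤ _ := add_le_add_right (norm_sub_le_norm_sub_add_norm_sub _
        (∑ j ∈ J, (∫ s, φ j s ∂μ) • ℓ (Φ j) • e) _) _
    _ < ε := by linarith

/-! ### Approximation in the mean by finitely many values -/

/-- A continuous partition of unity into functions supported in balls of radius `δ`. -/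
lemma exists_partition_of_unity_ball {M : Type*} [MetricSpace M] [CompactSpace M] {δ : ℝ}
    (hδ : 0 < δ) : ∃ (J : Finset M) (φ : M → M → ℝ), (∀ j, Continuous (φ j)) ∧
      (∀ j s, 0 ≤ φ j s) ∧ (∀ s, ∑ j ∈ J, φ j s = 1) ∧ ∀ j s, φ j s ≠ 0 → dist s j < δ := by
  obtain ⟨J, -, hJ⟩ := (isCompact_univ (X := M)).elim_nhds_subcover (fun x => Metric.ball x δ)
    fun x _ => Metric.ball_mem_nhds x hδ
  let ψ : M → M → ℝ := fun j s => max 0 (δ - dist s j)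
  have hψc : ∀ j, Continuous (ψ j) := fun j => by fun_prop
  have hψ0 : ∀ j s, 0 ≤ ψ j s := fun j s => le_max_left _ _
  have hpos : ∀ s, 0 < ∑ j ∈ J, ψ j s := by
    intro s
    obtain ⟨j, hj, hs⟩ := Set.mem_iUnion₂.mp (hJ (Set.mem_univ s))
    refine Finset.sum_pos' (fun i _ => hψ0 i s) ⟨j, hj, ?_⟩
    exact lt_max_of_lt_right (sub_pos.mpr hs)
  refine ⟨J, fun j s => ψ j s / ∑ i ∈ J, ψ i s, fun j => ?_, fun j s => ?_, fun s => ?_, ?_⟩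
  · exact (hψc j).div (by fun_prop) fun s => (hpos s).ne'
  · exact div_nonneg (hψ0 j s) (hpos s).le
  · rw [← Finset.sum_div, div_self (hpos s).ne']
  · intro j s h
    by_contra hd
    exact h (by simp [ψ, max_eq_left (sub_nonpos.mpr (not_lt.mp hd))])

lemma norm_toLp_rpow {Ω : Type*} [MeasurableSpace Ω] {P : Measure Ω} {p : ℝ≥0∞} (hp1 : 1 ≤ p)
    (hp : p ≠ ∞) {g : Ω → ℝ} (hg : MemLp g p P) :
    ‖hg.toLp g‖ ^ p.toReal = ∫ ω, |g ω| ^ p.toReal ∂P := by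
  have hp0 : 0 < p.toReal := ENNReal.toReal_pos (by positivity) hp
  have h0 : 0 ≤ ∫ ω, ‖g ω‖ ^ p.toReal ∂P := integral_nonneg fun ω => by positivity
  rw [Lp.norm_toLp, hg.eLpNorm_eq_integral_rpow_norm (by positivity) hp,
    ENNReal.toReal_ofReal (by positivity), Real.rpow_inv_rpow h0 hp0.ne']
  rfl

/-- Weighted averages of `p`-th powers of increments of a function over small distances tend to
zero at the points of continuity. -/
lemma tendsto_sum_rpow_increment {M : Type*} [MetricSpace M] {g : M → ℝ} {s : M}
    (hg : ContinuousAt g s) {r : ℝ} (hr : 0 < r) {δ : ℕ → ℝ} (hδ : Tendsto δ atTop (𝓝 0))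
    {J : ℕ → Finset M} {φ : ℕ → M → M → ℝ} (h0 : ∀ N j s, 0 ≤ φ N j s)
    (h1 : ∀ N s, ∑ j ∈ J N, φ N j s = 1) (hφ : ∀ N j s, φ N j s ≠ 0 → dist s j < δ N)
    {y : ℕ → M → M} (hy : ∀ N j, dist (y N j) j < δ N) :
    Tendsto (fun N => ∑ j ∈ J N, φ N j s * |g (y N j) - g j| ^ r) atTop (𝓝 0) := by
  rw [Metric.tendsto_nhds]
  intro ε hε
  -- Chosen so that `ρ ^ r = ε / 2`. Both `g (y N j)` and `g j` will lie within `ρ / 2` of `g s`, as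
  -- `y N j` and `j` are within `2 δ N < η` of `s`.
  set ρ := (ε / 2) ^ r⁻¹ with hρ
  have hρ0 : 0 < ρ := Real.rpow_pos_of_pos (half_pos hε) _
  obtain ⟨η, hη, hball⟩ := Metric.continuousAt_iff.mp hg (ρ / 2) (half_pos hρ0)
  filter_upwards [hδ.eventually (gt_mem_nhds (half_pos hη))] with N hN
  have hnn : 0 ≤ ∑ j ∈ J N, φ N j s * |g (y N j) - g j| ^ r :=
    Finset.sum_nonneg fun j _ => mul_nonneg (h0 N j s) (by positivity)
  rw [Real.dist_0_eq_abs, abs_of_nonneg hnn]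
  have hterm : ∀ j ∈ J N, φ N j s * |g (y N j) - g j| ^ r ≤ φ N j s * (ε / 2) := by
    intro j _
    rcases eq_or_ne (φ N j s) 0 with h | h
    · simp [h]
    refine mul_le_mul_of_nonneg_left ?_ (h0 N j s)
    have d1 := hφ N j s h
    have d2 := hy N j
    have d3 : dist (y N j) s < η := by
      have := dist_triangle_right (y N j) s j
      linarith
    have d4 : dist j s < η := by
      rw [dist_comm]
      linarith
    have e1 := hball d3
    have e2 := hball d4
    have e3 : |g (y N j) - g j| ≤ ρ := by
      have := dist_triangle_right (g (y N j)) (g j) (g s)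
      rw [← Real.dist_eq]
      linarith
    calc |g (y N j) - g j| ^ r ≤ ρ ^ r := Real.rpow_le_rpow (abs_nonneg _) e3 hr.le
      _ = ε / 2 := Real.rpow_inv_rpow (half_pos hε).le hr.ne'
  calc _ ≤ ∑ j ∈ J N, φ N j s * (ε / 2) := Finset.sum_le_sum hterm
    _ = ε / 2 := by rw [← Finset.sum_mul, h1, one_mul]
    _ < ε := half_lt_self hε

/-- A random function which is dominated in `L^p` and almost surely continuous almost everywhere is
approximated in the mean, as a function with values in `L^p`, by its values at finitely many
points. -/
lemma exists_partition_of_unity_approx {M Ω : Type*} [MetricSpace M] [CompactSpace M]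
    [MeasurableSpace M] [BorelSpace M] {μ : Measure M} [IsProbabilityMeasure μ]
    [MeasurableSpace Ω] {P : Measure Ω} [IsProbabilityMeasure P] {p : ℝ≥0∞} [Fact (1 ≤ p)]
    (hp : p ≠ ∞) {F : M × Ω → ℝ} (hF : ∀ s, MemLp (fun ω => F (s, ω)) p P) {S : Ω → ℝ}
    (hS : MemLp S p P) (hFS : ∀ᵐ ω ∂P, ∀ s, |F (s, ω)| ≤ S ω)
    (hcont : ∀ᵐ ω ∂P, ∀ᵐ s ∂μ, ContinuousAt (fun s => F (s, ω)) s) {ε : ℝ} (hε : 0 < ε) :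
    ∃ (J : Finset M) (φ : M → M → ℝ) (D : M → ℝ),
      (∀ j, Continuous (φ j)) ∧ (∀ j s, 0 ≤ φ j s) ∧ (∀ s, ∑ j ∈ J, φ j s = 1) ∧
      (∀ j ∈ J, ∀ s, φ j s ≠ 0 → ‖(hF s).toLp _ - (hF j).toLp _‖ ≤ D j) ∧
      ∑ j ∈ J, (∫ s, φ j s ∂μ) * D j < ε := by
  have hp1 : 1 ≤ p := Fact.out
  set r := p.toReal with hr
  have hr0 : 0 < r := ENNReal.toReal_pos (by positivity) hp
  have hr1 : 1 ≤ r := by simpa using ENNReal.toReal_mono hp hp1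
  let Φ : M → Lp ℝ p P := fun s => (hF s).toLp _
  have hΦS : ∀ s, ‖Φ s‖ ≤ ‖hS.toLp S‖ := by
    intro s
    refine Lp.norm_le_norm_of_ae_le ?_
    filter_upwards [hS.coeFn_toLp, (hF s).coeFn_toLp, hFS] with ω h1 h2 h3
    rw [h1, h2]
    exact (h3 s).trans (le_abs_self _)
  let δ : ℕ → ℝ := fun N => 1 / ((N : ℝ) + 1)
  have hδ0 : ∀ N, 0 < δ N := fun N => by positivity
  have hδ : Tendsto δ atTop (𝓝 0) := tendsto_one_div_add_atTop_nhds_zero_nat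
  choose J φ hc h0 h1 hφ using fun N => exists_partition_of_unity_ball (M := M) (hδ0 N)
  -- A near-maximiser of the `L^p` distance to `Φ j` over the ball. It does not depend on `ω`, so
  -- the measurability of pointwise oscillations never arises.
  have hy' : ∀ N j, ∃ y, dist y j < δ N ∧
      ∀ s, dist s j < δ N → ‖Φ s - Φ j‖ ≤ ‖Φ y - Φ j‖ + δ N := by
    intro N j
    have hb : BddAbove ((fun s => ‖Φ s - Φ j‖) '' Metric.ball j (δ N)) := by
      refine ⟨‖hS.toLp S‖ + ‖hS.toLp S‖, ?_⟩
      rintro _ ⟨s, -, rfl⟩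
      exact (norm_sub_le _ _).trans (add_le_add (hΦS s) (hΦS j))
    have hne : ((fun s => ‖Φ s - Φ j‖) '' Metric.ball j (δ N)).Nonempty :=
      ⟨_, j, Metric.mem_ball_self (hδ0 N), rfl⟩
    obtain ⟨_, ⟨y, hyb, rfl⟩, hy⟩ := exists_lt_of_lt_csSup hne (sub_lt_self _ (hδ0 N))
    refine ⟨y, hyb, fun s hs => ?_⟩
    have := le_csSup hb ⟨s, Metric.mem_ball.mpr hs, rfl⟩
    dsimp only at hy this
    linarith
  choose y hyd hys using hy'
  have hint : ∀ N j, Integrable (φ N j) μ := fun N j =>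
    (hc N j).integrable_of_hasCompactSupport (HasCompactSupport.of_compactSpace _)
  let w : ℕ → M → ℝ := fun N j => ∫ s, φ N j s ∂μ
  have hw0 : ∀ N j, 0 ≤ w N j := fun N j => integral_nonneg (h0 N j)
  have hw1 : ∀ N, ∑ j ∈ J N, w N j = 1 := by
    intro N
    simp only [w]
    rw [← integral_finsetSum _ fun j _ => hint N j]
    simp [h1]
  let K : ℕ → Ω → ℝ := fun N ω => ∑ j ∈ J N, w N j * |F (y N j, ω) - F (j, ω)| ^ r
  have hinc : ∀ N j, MemLp (fun ω => F (y N j, ω) - F (j, ω)) p P := fun N j =>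
    (hF (y N j)).sub (hF j)
  have hincint : ∀ N j, Integrable (fun ω => |F (y N j, ω) - F (j, ω)| ^ r) P := fun N j =>
    (hinc N j).integrable_norm_rpow (by positivity) hp
  have hincS : ∀ᵐ ω ∂P, ∀ N j, |F (y N j, ω) - F (j, ω)| ^ r ≤ |2 * S ω| ^ r := by
    filter_upwards [hFS] with ω hω N j
    refine Real.rpow_le_rpow (abs_nonneg _) (le_trans ?_ (le_abs_self _)) hr0.le
    refine (abs_sub _ _).trans ?_
    linarith [hω (y N j), hω j]
  -- Dominated convergence twice: in `s` for fixed `ω`, using continuity `μ`-almost everywhere, then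
  -- in `ω` with majorant `|2 S|^r`.
  have hK : Tendsto (fun N => ∫ ω, K N ω ∂P) atTop (𝓝 0) := by
    have h2S : Integrable (fun ω => |2 * S ω| ^ r) P :=
      (hS.const_mul 2).integrable_norm_rpow (by positivity) hp
    have := tendsto_integral_of_dominated_convergence (F := K) (f := fun _ => (0 : ℝ)) (μ := P)
      (fun ω => |2 * S ω| ^ r)
      (fun N => (integrable_finsetSum _ fun j _ => (hincint N j).const_mul _).aestronglyMeasurable)
      h2S (fun N => ?_) ?_
    · simpa using this
    · filter_upwards [hincS] with ω hω
      have hnn : 0 ≤ K N ω := Finset.sum_nonneg fun j _ => mul_nonneg (hw0 N j) (by positivity)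
      rw [Real.norm_of_nonneg hnn]
      calc K N ω ≤ ∑ j ∈ J N, w N j * |2 * S ω| ^ r :=
            Finset.sum_le_sum fun j _ => mul_le_mul_of_nonneg_left (hω N j) (hw0 N j)
        _ = |2 * S ω| ^ r := by rw [← Finset.sum_mul, hw1, one_mul]
    · filter_upwards [hincS, hcont] with ω hω hωc
      have hKω : ∀ N, K N ω =
          ∫ s, ∑ j ∈ J N, φ N j s * |F (y N j, ω) - F (j, ω)| ^ r ∂μ := by
        intro N
        rw [integral_finsetSum _ fun j _ => (hint N j).mul_const _]
        exact Finset.sum_congr rfl fun j _ => (integral_mul_const _ _).symm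
      simp only [hKω]
      have := tendsto_integral_of_dominated_convergence
        (F := fun N s => ∑ j ∈ J N, φ N j s * |F (y N j, ω) - F (j, ω)| ^ r)
        (f := fun _ => (0 : ℝ)) (μ := μ) (fun _ => |2 * S ω| ^ r)
        (fun N => (integrable_finsetSum _ fun j _ => (hint N j).mul_const _).aestronglyMeasurable)
        (integrable_const _) (fun N => ae_of_all _ fun s => ?_) ?_
      · simpa using this
      · rw [Real.norm_of_nonneg (Finset.sum_nonneg fun j _ =>
          mul_nonneg (h0 N j s) (by positivity))]
        calc _ ≤ ∑ j ∈ J N, φ N j s * |2 * S ω| ^ r :=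
              Finset.sum_le_sum fun j _ => mul_le_mul_of_nonneg_left (hω N j) (h0 N j s)
          _ = |2 * S ω| ^ r := by rw [← Finset.sum_mul, h1, one_mul]
      · filter_upwards [hωc] with s hs
        exact tendsto_sum_rpow_increment hs hr0 hδ h0 h1 hφ hyd
  have hle : ∀ N, ∑ j ∈ J N, w N j * ‖Φ (y N j) - Φ j‖ ≤ (∫ ω, K N ω ∂P) ^ r⁻¹ := by
    intro N
    have hsum0 : 0 ≤ ∑ j ∈ J N, w N j * ‖Φ (y N j) - Φ j‖ :=
      Finset.sum_nonneg fun j _ => mul_nonneg (hw0 N j) (norm_nonneg _)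
    rw [Real.le_rpow_inv_iff_of_pos hsum0 (integral_nonneg fun ω =>
      Finset.sum_nonneg fun j _ => mul_nonneg (hw0 N j) (by positivity)) hr0]
    -- Jensen's inequality for the weights `w N j`, which sum to `1`.
    calc _ ≤ ∑ j ∈ J N, w N j * ‖Φ (y N j) - Φ j‖ ^ r :=
          Real.rpow_arith_mean_le_arith_mean_rpow _ _ _ (fun j _ => hw0 N j) (hw1 N)
            (fun j _ => norm_nonneg _) hr1
      _ = ∑ j ∈ J N, w N j * ∫ ω, |F (y N j, ω) - F (j, ω)| ^ r ∂P := by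
          refine Finset.sum_congr rfl fun j _ => ?_
          rw [← norm_toLp_rpow hp1 hp (hinc N j)]
          rfl
      _ = ∫ ω, K N ω ∂P := by
          simp only [K]
          rw [integral_finsetSum _ fun j _ => (hincint N j).const_mul _]
          exact Finset.sum_congr rfl fun j _ => (integral_const_mul _ _).symm
  have hlim : Tendsto (fun N => (∫ ω, K N ω ∂P) ^ r⁻¹ + δ N) atTop (𝓝 0) := by
    have := (hK.rpow_const (p := r⁻¹) (Or.inr (by positivity))).add hδ
    rwa [Real.zero_rpow (by positivity), add_zero] at this
  obtain ⟨N, hN⟩ := (hlim.eventually (gt_mem_nhds hε)).exists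
  refine ⟨J N, φ N, fun j => ‖Φ (y N j) - Φ j‖ + δ N, hc N, h0 N, h1 N,
    fun j _ s hs => hys N j s (hφ N j s hs), ?_⟩
  calc _ = ∑ j ∈ J N, w N j * ‖Φ (y N j) - Φ j‖ + δ N := by
        simp only [mul_add, Finset.sum_add_distrib, ← Finset.sum_mul]
        rw [hw1, one_mul]
    _ ≤ (∫ ω, K N ω ∂P) ^ r⁻¹ + δ N := by linarith [hle N]
    _ < ε := hN

/-! ### Riemann integrability and almost everywhere continuity -/

lemma comap_volume_Icc_le {a b : ℝ} (u v : Set.Icc a b) :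
    (volume : Measure ℝ).comap ((↑) : Set.Icc a b → ℝ) (Set.Icc u v) ≤
      ENNReal.ofReal ((v : ℝ) - u) := by
  rw [(MeasurableEmbedding.subtype_coe measurableSet_Icc).comap_apply, ← Real.volume_Icc]
  refine measure_mono ?_
  rintro _ ⟨s, hs, rfl⟩
  exact ⟨hs.1, hs.2⟩

/-- A Riemann-integrable function is continuous almost everywhere. -/
lemma RiemannIntegrable.ae_continuousAt {a b : ℝ} {f : Set.Icc a b → ℝ}
    (hf : RiemannIntegrable f) :
    ∀ᵐ s ∂((volume : Measure ℝ).comap ((↑) : Set.Icc a b → ℝ)), ContinuousAt f s := by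
  set ν := (volume : Measure ℝ).comap ((↑) : Set.Icc a b → ℝ) with hν
  obtain ⟨⟨C, hC⟩, hf⟩ := hf
  have hab : ∀ A : Set (Set.Icc a b), BddAbove (f '' A) := fun A => by
    refine ⟨C, ?_⟩
    rintro _ ⟨t, -, rfl⟩
    exact (abs_le.mp (hC t)).2
  have hbe : ∀ A : Set (Set.Icc a b), BddBelow (f '' A) := fun A => by
    refine ⟨-C, ?_⟩
    rintro _ ⟨t, -, rfl⟩
    exact (abs_le.mp (hC t)).1
  let B : ℝ → Set (Set.Icc a b) := fun r => {s | ∀ U ∈ 𝓝 s, ∃ t ∈ U, r ≤ |f t - f s|}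
  have hB : ∀ r, 0 < r → ν (B r) = 0 := by
    intro r hr
    refine le_antisymm (ENNReal.le_of_forall_pos_le_add fun η hη _ => ?_) zero_le
    rw [zero_add]
    -- Chebyshev: if the Darboux sums differ by less than `r η`, the intervals with oscillation at
    -- least `r` have total length at most `η`.
    obtain ⟨n, x, hx, hx0, hxn, hsum⟩ := hf (r * η) (by positivity)
    let osc : Fin n → ℝ := fun i => sSup (f '' Set.Icc (x i.castSucc) (x i.succ)) -
        sInf (f '' Set.Icc (x i.castSucc) (x i.succ))
    let I : Finset (Fin n) := Finset.univ.filter fun i => r ≤ osc i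
    have hlen : ∀ i : Fin n, 0 ≤ (x i.succ : ℝ) - x i.castSucc := fun i =>
      sub_nonneg.mpr (hx (Fin.castSucc_lt_succ (i := i)).le)
    have hosc : ∀ i, 0 ≤ osc i := by
      intro i
      have hm : x i.castSucc ∈ Set.Icc (x i.castSucc) (x i.succ) :=
        ⟨le_rfl, hx (Fin.castSucc_lt_succ (i := i)).le⟩
      exact sub_nonneg.mpr ((csInf_le (hbe _) (Set.mem_image_of_mem f hm)).trans
        (le_csSup (hab _) (Set.mem_image_of_mem f hm)))
    have hcover : B r ⊆ (⋃ j : Fin (n + 1), Set.Icc (x j) (x j)) ∪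
        ⋃ i ∈ I, Set.Icc (x i.castSucc) (x i.succ) := by
      intro s hs
      by_contra hns
      simp only [Set.mem_union, Set.mem_iUnion, not_or, not_exists, Set.Icc_self,
        Set.mem_singleton_iff] at hns
      obtain ⟨hne, hnI⟩ := hns
      -- Were `s` strictly between consecutive nodes, their interval would be a neighbourhood of
      -- `s`, so its oscillation would be at least `r`, placing it in `I`. So `s` lies beyond every
      -- node, even `b`.
      have hlt : ∀ j, x j < s := by
        intro j
        induction j using Fin.induction with
        | zero =>
          refine lt_of_le_of_ne ?_ fun h => hne 0 h.symm
          rw [← Subtype.coe_le_coe, hx0]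
          exact s.2.1
        | succ i ih =>
          refine lt_of_le_of_ne ?_ fun h => hne _ h.symm
          by_contra hlt
          rw [not_le] at hlt
          obtain ⟨t, ht, hrt⟩ := hs _ (Icc_mem_nhds ih hlt)
          refine hnI i ?_ ⟨ih.le, hlt.le⟩
          simp only [I, Finset.mem_filter, Finset.mem_univ, true_and, osc]
          have hsm := Set.mem_image_of_mem f (Set.mem_Icc.mpr ⟨ih.le, hlt.le⟩)
          have htm := Set.mem_image_of_mem f ht
          have h1 := le_csSup (hab _) hsm
          have h2 := le_csSup (hab _) htm
          have h3 := csInf_le (hbe _) hsm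
          have h4 := csInf_le (hbe _) htm
          rcases le_abs'.mp hrt with h | h <;> linarith
      have := hlt (Fin.last n)
      rw [← Subtype.coe_lt_coe, hxn] at this
      exact this.not_ge s.2.2
    have hpts : ν (⋃ j : Fin (n + 1), Set.Icc (x j) (x j)) = 0 := by
      rw [measure_iUnion_null_iff]
      intro j
      simpa using comap_volume_Icc_le (x j) (x j)
    have hIsum : ∑ i ∈ I, ((x i.succ : ℝ) - x i.castSucc) ≤ η := by
      have h1 : r * ∑ i ∈ I, ((x i.succ : ℝ) - x i.castSucc) ≤ r * η := by
        refine le_trans ?_ hsum.le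
        rw [Finset.mul_sum]
        refine (Finset.sum_le_sum fun i hi => ?_).trans
          (Finset.sum_le_univ_sum_of_nonneg fun i => mul_nonneg (hosc i) (hlen i))
        exact mul_le_mul_of_nonneg_right (Finset.mem_filter.mp hi).2 (hlen i)
      exact le_of_mul_le_mul_left h1 hr
    calc ν (B r) ≤ ν (⋃ j : Fin (n + 1), Set.Icc (x j) (x j)) +
          ν (⋃ i ∈ I, Set.Icc (x i.castSucc) (x i.succ)) :=
        (measure_mono hcover).trans (measure_union_le _ _)
      _ ≤ ∑ i ∈ I, ENNReal.ofReal ((x i.succ : ℝ) - x i.castSucc) := by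
        rw [hpts, zero_add]
        exact (measure_biUnion_finset_le _ _).trans
          (Finset.sum_le_sum fun i _ => comap_volume_Icc_le _ _)
      _ = ENNReal.ofReal (∑ i ∈ I, ((x i.succ : ℝ) - x i.castSucc)) :=
        (ENNReal.ofReal_sum_of_nonneg fun i _ => hlen i).symm
      _ ≤ η := by
        rw [← ENNReal.ofReal_coe_nnreal]
        exact ENNReal.ofReal_le_ofReal hIsum
  have hall : ∀ᵐ s ∂ν, ∀ m : ℕ, s ∉ B (1 / ((m : ℝ) + 1)) :=
    ae_all_iff.mpr fun m => measure_eq_zero_iff_ae_notMem.mp (hB _ (by positivity))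
  filter_upwards [hall] with s hs
  rw [Metric.continuousAt_iff']
  intro ε hε
  obtain ⟨m, hm⟩ := exists_nat_one_div_lt hε
  have := hs m
  simp only [B, Set.mem_ofPred_eq, not_forall, not_exists, not_and, not_le] at this
  obtain ⟨U, hU, h⟩ := this
  filter_upwards [hU] with t ht
  exact (h t ht).trans hm

/-- A function on `M` is continuous at `π s`, for `s` not an end point, if its pull-back to `[a,b]`
is continuous at `s`. -/
lemma IsIntervalOrCircle.continuousAt {M : Type*} [TopologicalSpace M] [T2Space M] {a b : ℝ}
    {π : Set.Icc a b → M} (hπ : IsIntervalOrCircle a b π) {f : M → ℝ} {s : Set.Icc a b}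
    (ha : (s : ℝ) ≠ a) (hb : (s : ℝ) ≠ b) (hf : ContinuousAt (fun t => f (π t)) s) :
    ContinuousAt f (π s) := by
  have h1 : π ⁻¹' {π s} = {s} := by
    ext t
    simp only [Set.mem_preimage, Set.mem_singleton_iff]
    refine ⟨fun h => ?_, fun h => h ▸ rfl⟩
    rcases hπ.eq_or_endpoints s t h.symm with h | h | h
    · exact h.symm
    · exact absurd h.1 ha
    · exact absurd h.1 hb
  -- `π` is closed, from a compact to a Hausdorff space, so neighbourhoods of the one-point fibre
  -- come from neighbourhoods of `π s`.
  have h2 : comap π (𝓝 (π s)) = 𝓝 s := by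
    rw [hπ.continuous.isClosedMap.comap_nhds_eq hπ.continuous, h1, nhdsSet_singleton]
  rw [ContinuousAt, ← map_comap_of_surjective hπ.surjective (𝓝 (π s)), h2, tendsto_map'_iff]
  exact hf

/-- A function on `M` whose pull-back is Riemann integrable is continuous almost everywhere for the
image of any absolutely continuous measure on `[a,b]`. -/
lemma IsIntervalOrCircle.ae_continuousAt {M : Type*} [TopologicalSpace M] [T2Space M]
    [MeasurableSpace M] [BorelSpace M] {a b : ℝ}
    {π : Set.Icc a b → M} (hπ : IsIntervalOrCircle a b π) {f : M → ℝ}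
    (hf : RiemannIntegrable fun s => f (π s)) {ν : Measure (Set.Icc a b)}
    (hν : ν ≪ (volume : Measure ℝ).comap ((↑) : Set.Icc a b → ℝ)) :
    ∀ᵐ s ∂(ν.map π), ContinuousAt f s := by
  rw [ae_map_iff hπ.continuous.aemeasurable (IsGδ.setOfPred_continuousAt f).measurableSet]
  refine hν.ae_le ?_
  have hpt : ∀ c : ℝ, ∀ᵐ s : Set.Icc a b
      ∂((volume : Measure ℝ).comap ((↑) : Set.Icc a b → ℝ)), (s : ℝ) ≠ c := by
    intro c
    refine (measure_eq_zero_iff_ae_notMem (s := {s : Set.Icc a b | (s : ℝ) = c})).mp ?_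
    rw [(MeasurableEmbedding.subtype_coe measurableSet_Icc).comap_apply]
    refine measure_mono_null (t := {c}) ?_ (by simp)
    rintro _ ⟨s, hs, rfl⟩
    exact hs
  filter_upwards [hf.ae_continuousAt, hpt a, hpt b] with s h1 h2 h3
  exact hπ.continuousAt h2 h3 h1

/-! ### The theorem -/

theorem corollary4p7 {M Ω : Type*} [MetricSpace M] [MeasurableSpace M] [BorelSpace M]
    [MeasurableSpace Ω] (a b : ℝ) (hab : a < b) (π : Set.Icc a b → M)
    (hπ : IsIntervalOrCircle a b π)
    (τ : M → M) (hτ : Continuous τ)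
    (μ : Measure M) [IsProbabilityMeasure μ] (hμ : UniquelyErgodicWith τ μ)
    (hdens : ∃ ρ : Set.Icc a b → ℝ≥0, Continuous ρ ∧
      μ = Measure.map π 
        (((volume : Measure ℝ).comap ((↑) : Set.Icc a b → ℝ)).withDensity fun t => (ρ t : ℝ≥0∞)))
    (P : Measure Ω) [IsProbabilityMeasure P]
    (d : ℕ) (θ : (Fin d → ℤ) → Ω → Ω) (hθ : IsMeasurePreservingGroup P θ)
    (hmix : StronglyMixing P θ)
    (κ : M → Fin d → ℤ) (hκ : Measurable κ) (hgrowth : CouplingGrowth τ κ)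
    (p : ℝ≥0∞) (hp1 : 1 ≤ p) (hp : p ≠ ∞)
    (F : M × Ω → ℝ) (hFmeas : Measurable F) (hF : MemLp F p (μ.prod P))
    (hFsup : MemLp (fun ω => ⨆ t : M, |F (t, ω)|) p P)
    (hFR : ∀ᵐ ω ∂P, RiemannIntegrable fun s : Set.Icc a b => F (π s, ω)) :
    Tendsto
      (fun n : ℕ => ⨆ t : M, eLpNorm
        (fun ω => 1 / (n : ℝ) * ∑ i ∈ Finset.range n, F (τ^[i] t, θ (birkhoffSum τ κ i t) ω)
          - ∫ z, F z ∂(μ.prod P)) p P)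
      atTop (𝓝 0) := by
  have : Fact (1 ≤ p) := ⟨hp1⟩
  have : CompactSpace M := by
    rw [← isCompact_univ_iff, ← hπ.surjective.range_eq]
    exact isCompact_range hπ.continuous
  -- Riemann integrability includes boundedness, so for almost every `ω` the supremum is genuine
  -- rather than the default `0`.
  have hFS : ∀ᵐ ω ∂P, ∀ s, |F (s, ω)| ≤ ⨆ t : M, |F (t, ω)| := by
    filter_upwards [hFR] with ω hω s
    obtain ⟨C, hC⟩ := hω.1
    refine le_ciSup (f := fun t => |F (t, ω)|) ⟨C, ?_⟩ s
    rintro _ ⟨t, rfl⟩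
    obtain ⟨u, rfl⟩ := hπ.surjective t
    exact hC u
  have hFs : ∀ s, MemLp (fun ω => F (s, ω)) p P := fun s => by
    refine hFsup.mono (hFmeas.comp measurable_prodMk_left).aestronglyMeasurable ?_
    filter_upwards [hFS] with ω hω
    exact (hω s).trans (le_abs_self _)
  have hcont : ∀ᵐ ω ∂P, ∀ᵐ s ∂μ, ContinuousAt (fun s => F (s, ω)) s := by
    obtain ⟨ρ, -, rfl⟩ := hdens
    filter_upwards [hFR] with ω hω
    exact hπ.ae_continuousAt (f := fun s => F (s, ω)) hω (withDensity_absolutelyContinuous _ _)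
  have hFint : Integrable F (μ.prod P) := hF.integrable hp1
  have hℓ : ∀ s, integralLp P p ((hFs s).toLp _) = ∫ ω, F (s, ω) ∂P := fun s =>
    integralLp_toLp P p (hFs s)
  set e : Lp ℝ p P := (memLp_const (1 : ℝ)).toLp (fun _ : Ω => (1 : ℝ)) with he
  have hmain := tendsto_average_of_approx (μ := μ) (τ := τ) (Φ := fun s => (hFs s).toLp _)
    (fun i t => hθ.koopman p (birkhoffSum τ κ i t)) (e := e)
    (by
      rw [he, Lp.norm_toLp, eLpNorm_const _ (by positivity) (IsProbabilityMeasure.ne_zero P)]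
      simp)
    (integralLp P p) (abs_integralLp_le P p)
    (by simpa only [hℓ] using hFint.integral_prod_left)
    (fun f hf => hμ.tendsto_average hτ hf)
    (fun f hf hf1 G => tendsto_average_koopman hτ hμ hθ hmix hgrowth hp hf hf1 G)
    (fun ε hε => exists_partition_of_unity_approx hp hFs hFsup hFS hcont hε)
  simp only [hℓ] at hmain
  rw [← integral_prod F hFint] at hmain
  have hnorm := (hmain.sub_const ((∫ z, F z ∂(μ.prod P)) • e)).enorm
  rw [sub_self, enorm_zero] at hnorm
  rw [ENNReal.tendsto_nhds_zero] at hnorm ⊢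
  intro ε hε
  -- The factor `⊤` forces `B` to hold for every `t`, so one threshold for `n` bounds the whole
  -- supremum.
  obtain ⟨A, hA, B, hB, hAB⟩ := eventually_prod_iff.mp (hnorm ε hε)
  filter_upwards [hA] with n hn
  refine iSup_le fun t => ?_
  refine le_trans (le_of_eq ?_) (hAB hn (eventually_top.mp hB t))
  have hmp : ∀ i, MemLp (fun ω => F (τ^[i] t, θ (birkhoffSum τ κ i t) ω)) p P := fun i =>
    (hFs (τ^[i] t)).comp_measurePreserving (hθ.measurePreserving (birkhoffSum τ κ i t))
  have hterm : ∀ i, hθ.koopman p (birkhoffSum τ κ i t) ((hFs (τ^[i] t)).toLp _) =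
      (hmp i).toLp _ := fun i => rfl
  simp only [hterm]
  rw [Lp.enorm_def]
  refine eLpNorm_congr_ae ?_
  filter_upwards [Lp.coeFn_sub ((1 / (n : ℝ)) • ∑ i ∈ Finset.range n, (hmp i).toLp _)
      ((∫ z, F z ∂(μ.prod P)) • e),
    Lp.coeFn_smul (1 / (n : ℝ)) (∑ i ∈ Finset.range n, (hmp i).toLp _),
    Lp.coeFn_smul (∫ z, F z ∂(μ.prod P)) e,
    (memLp_const (1 : ℝ)).coeFn_toLp (f := fun _ : Ω => (1 : ℝ)) (p := p) (μ := P),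
    Lp.coeFn_fun_finsetSum (Finset.range n) (fun i => (hmp i).toLp _),
    ae_all_iff.mpr fun i => (hmp i).coeFn_toLp] with ω h1 h2 h3 h4 h5 h6
  rw [h1, Pi.sub_apply, h2, h3, Pi.smul_apply, Pi.smul_apply, h5, h4]
  simp [h6]
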